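/- Let $\mathbb{D}=\{z\in\mathbb{C}:|z|<1\}$. The Hardy space $H^2$ is the set of all holomorphic $f:\mathbb{D}\to\mathbb{C}$ with $$\sup_{0\le r<1}\Big(\frac1{2\pi}\int_0^{2\pi}|f(re^{it})|^2\,dt\Big)^{1/2}<\infty .$$ An inner function is a holomorphic function $\theta$ on $\mathbb{D}$ with $|\theta(z)|\le 1$ for all $z\in\mathbb{D}$ whose radial limit $\lim_{r\to1^-}\theta(re^{it})$ exists and has modulus $1$ for almost every $t$. A Schur function is a holomorphic function $g$ on $\mathbb{D}$ with $\sup_{z\in\mathbb{D}}|g(z)|\le 1$. Theorem. Let $\varphi:\mathbb{D}\to\mathbb{D}$ be holomorphic, let $\theta$ be an inner function, let $\theta H^2=\{\theta h: h\in H^2\}$, and let $C_\varphi f=f\circ\varphi$. Then the following are equivalent: (a) $\theta H^2$ is invariant under $C_\varphi$, that is, $C_\varphi(\theta H^2)\subseteq\theta H^2$; (b) the quotient $\dfrac{\theta\circ\varphi}{\theta}$ is a Schur function, after removal of its removable singularities: there is a Schur function $g$ with $g(z)=\theta(\varphi(z))/\theta(z)$ for every $z\in\mathbb{D}$ with $\theta(z)\ne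 0$. -/

import Mathlib

noncomputable section

namespace HardyDisk

/-- The open unit disk `𝔻` of the complex plane. Functions on `𝔻` are represented by functions
`ℂ → ℂ`, of which only the restriction to `𝔻` matters. -/
abbrev disk : Set ℂ := Metric.ball 0 1

/-- Holomorphic functions on the disk. -/
def Holomorphic (f : ℂ → ℂ) : Prop := DifferentiableOn ℂ f disk

/-- Holomorphic self-maps of the disk. -/
def IsSelfMap (φ : ℂ → ℂ) : Prop := Holomorphic φ ∧ Set.MapsTo φ disk disk

/-- The quadratic mean `((1 / 2π) ∫₀^{2π} |f (r e^{it})|² dt)^{1/2}` on the circle of radius `r`. -/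
def quadraticMean (f : ℂ → ℂ) (r : ℝ) : ℝ :=
  Real.sqrt (Real.circleAverage (fun z => ‖f z‖ ^ 2) 0 r)

/-- The Hardy space `H²`: holomorphic functions on the disk whose quadratic means over the circles
of radius `r`, `0 ≤ r < 1`, are bounded. -/
def H2 : Set (ℂ → ℂ) :=
  {f | Holomorphic f ∧ BddAbove (quadraticMean f '' Set.Ico 0 1)}

/-- Inner functions: holomorphic functions on the disk that are bounded by one in modulus and have,
for almost every `t ∈ (0, 2π]`, a radial limit of modulus one at `e^{it}`. -/
def IsInner (θ : ℂ → ℂ) : Prop :=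
  Holomorphic θ ∧ (∀ z ∈ disk, ‖θ z‖ ≤ 1) ∧
    ∀ᵐ t ∂(MeasureTheory.volume.restrict (Set.Ioc 0 (2 * Real.pi))),
      ∃ w : ℂ, ‖w‖ = 1 ∧
        Filter.Tendsto (fun r : ℝ => θ (circleMap 0 r t)) (nhdsWithin 1 (Set.Iio 1)) (nhds w)

/-- The Schur class: holomorphic functions on the disk that are bounded by one in modulus. -/
def Schur : Set (ℂ → ℂ) :=
  {g | Holomorphic g ∧ ∀ z ∈ disk, ‖g z‖ ≤ 1}

/-- The space `θH² = {θh : h ∈ H²}`, as a set of functions on the disk. -/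
def mulH2 (θ : ℂ → ℂ) : Set (ℂ → ℂ) :=
  {F | ∃ h ∈ H2, Set.EqOn F (fun z => θ z * h z) disk}

/-- The composition operator `C_φ f = f ∘ φ`. -/
def compOp (φ f : ℂ → ℂ) : ℂ → ℂ := f ∘ φ

/-- The quotient `u / v` is a Schur function on the disk: some Schur function takes the value
`u z / v z` at every point `z` of the disk with `v z ≠ 0`. For a holomorphic `v` that does not
vanish identically the zeros are isolated, so this Schur function is unique on the disk: it is the
quotient with its removable singularities removed. -/
def QuotientIsSchur (u v : ℂ → ℂ) : Prop :=
  ∃ g ∈ Schur, ∀ z ∈ disk, v z ≠ 0 → g z = u z / v z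

end HardyDisk

end

open MeasureTheory Filter Topology Complex Metric Set Real

namespace HardyDisk

/-! If `θ ∘ φ = θ g` with `g` Schur, then `C_φ (θ h) = θ · g · (h ∘ φ)`. Littlewood subordination
puts `h ∘ φ` in `H²`, and multiplication by `g` keeps it there.

Conversely, invariance applied to `θ = θ · 1` gives `θ ∘ φ = θ h` with `h ∈ H²`, and `‖h‖ ≤ 1` must
be shown. Boundary values of `h` are avoided: since `‖θ h‖ ≤ 1`, one has `‖h‖ ≤ 1 + ‖h‖ (1 - ‖θ‖)`
on circles of radius `r < 1`. In the Poisson integral of this bound the error vanishes as `r → 1`,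
because `h` is bounded in mean square and `1 - ‖θ‖` tends to zero in mean square. -/

lemma isPreconnected_disk : IsPreconnected disk := (convex_ball 0 1).isPreconnected

lemma closedBall_subset_disk {r : ℝ} (hr : r < 1) : closedBall (0 : ℂ) r ⊆ disk :=
  closedBall_subset_ball hr

lemma sphere_subset_disk {r : ℝ} (hr : r < 1) : sphere (0 : ℂ) r ⊆ disk :=
  sphere_subset_closedBall.trans (closedBall_subset_disk hr)

/-- A continuous function on the disk is integrable over every centred circle in the disk. -/
lemma circleIntegrable_of_continuousOn_disk {E : Type*} [NormedAddCommGroup E] {f : ℂ → E}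
    (hf : ContinuousOn f disk) {r : ℝ} (hr0 : 0 ≤ r) (hr : r < 1) : CircleIntegrable f 0 r :=
  (hf.mono (sphere_subset_disk hr)).circleIntegrable hr0

/-- Membership in `H²` in terms of the integral means of the squared modulus. -/
lemma mem_H2_iff {f : ℂ → ℂ} :
    f ∈ H2 ↔ Holomorphic f ∧
      ∃ M, ∀ r ∈ Ico (0 : ℝ) 1, circleAverage (fun z => ‖f z‖ ^ 2) 0 r ≤ M := by
  refine and_congr_right fun _ => ⟨?_, ?_⟩
  · rintro ⟨M, hM⟩
    refine ⟨M ^ 2, fun r hr => ?_⟩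
    have h1 : √(circleAverage (fun z => ‖f z‖ ^ 2) 0 r) ≤ M := hM ⟨r, hr, rfl⟩
    exact (Real.sqrt_le_iff.1 h1).2
  · rintro ⟨M, hM⟩
    refine ⟨√M, ?_⟩
    rintro _ ⟨r, hr, rfl⟩
    exact Real.sqrt_le_sqrt (hM r hr)

lemma one_mem_H2 : (fun _ => 1 : ℂ → ℂ) ∈ H2 :=
  mem_H2_iff.2 ⟨differentiableOn_const _, 1, fun r _ => by simp [circleAverage_const]⟩

/-- Multiplication by a Schur function maps `H²` into itself. -/
lemma Schur.mul_mem_H2 {g f : ℂ → ℂ} (hg : g ∈ Schur) (hf : f ∈ H2) :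
    (fun z => g z * f z) ∈ H2 := by
  obtain ⟨hfh, M, hM⟩ := mem_H2_iff.1 hf
  refine mem_H2_iff.2 ⟨hg.1.mul hfh, M, fun r hr => le_trans ?_ (hM r hr)⟩
  have hc : ContinuousOn g disk := hg.1.continuousOn
  have hc' : ContinuousOn f disk := hfh.continuousOn
  refine circleAverage_mono (circleIntegrable_of_continuousOn_disk (by fun_prop) hr.1 hr.2)
    (circleIntegrable_of_continuousOn_disk (by fun_prop) hr.1 hr.2) fun z hz => ?_
  rw [abs_of_nonneg hr.1] at hz
  have := hg.2 z (sphere_subset_disk hr.2 hz)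
  rw [norm_mul]
  gcongr
  exact mul_le_of_le_one_left (norm_nonneg _) this

/-! ### Poisson integrals over circles inside the disk -/

section Poisson

variable {w : ℂ} {R : ℝ}

lemma continuousOn_re_herglotzRieszKernel (hw : w ∈ ball 0 R) :
    ContinuousOn (fun ζ => (herglotzRieszKernel 0 w ζ).re) (sphere 0 R) := by
  have := continuousOn_herglotzRieszKernel_sphere hw
  rw [abs_of_pos (pos_of_mem_ball hw)] at this
  exact continuous_re.comp_continuousOn this

lemma re_herglotzRieszKernel_nonneg (hw : w ∈ ball 0 R) {ζ : ℂ} (hζ : ζ ∈ sphere 0 R) :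
    0 ≤ (herglotzRieszKernel 0 w ζ).re := by
  refine le_trans ?_ (le_re_herglotzRieszKernel hζ hw)
  have : ‖w‖ < R := by simpa using hw
  have := norm_nonneg w
  rw [sub_zero]
  exact div_nonneg (by linarith) (by linarith)

lemma re_herglotzRieszKernel_le' (hw : w ∈ ball 0 R) {ζ : ℂ} (hζ : ζ ∈ sphere 0 R) :
    (herglotzRieszKernel 0 w ζ).re ≤ (R + ‖w‖) / (R - ‖w‖) := by
  simpa [herglotzRieszKernel_def] using re_herglotzRieszKernel_le hζ hw

/-- The modulus of a holomorphic function is dominated by its Poisson integral. -/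
lemma norm_le_circleAverage_re_herglotzRieszKernel {f : ℂ → ℂ} (hf : Holomorphic f) (hR : R < 1)
    (hw : w ∈ ball 0 R) :
    ‖f w‖ ≤ circleAverage (fun ζ => (herglotzRieszKernel 0 w ζ).re * ‖f ζ‖) 0 R := by
  have hR0 : 0 < R := pos_of_mem_ball hw
  have hd : DiffContOnCl ℂ f (ball 0 R) := by
    refine DifferentiableOn.diffContOnCl ?_
    rw [closure_ball 0 hR0.ne']
    exact hf.mono (closedBall_subset_disk hR)
  rw [← hd.circleAverage_re_herglotzRieszKernel_smul hw]
  have h2π : (0 : ℝ) ≤ 2 * π := by positivity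
  simp only [circleAverage_def, norm_smul, smul_eq_mul]
  rw [Real.norm_of_nonneg (by positivity)]
  gcongr
  refine (intervalIntegral.norm_integral_le_integral_norm h2π).trans_eq ?_
  refine intervalIntegral.integral_congr fun t _ => ?_
  simp only [Pi.smul_apply', Function.comp_apply, norm_smul]
  rw [Real.norm_of_nonneg (re_herglotzRieszKernel_nonneg hw (circleMap_mem_sphere 0 hR0.le t))]

/-- The Poisson integral reproduces the constant `1`; the complex identity descends to the reals by
injectivity of the coercion. -/
lemma circleAverage_re_herglotzRieszKernel (hw : w ∈ ball 0 R) :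
    circleAverage (fun ζ => (herglotzRieszKernel 0 w ζ).re) 0 R = 1 := by
  have h := re_circleAverage_herglotzRieszKernel_smul
    (g := fun _ => 1) (circleIntegrable_const 1 0 R) hw
  have h1 := (diffContOnCl_const (c := (1 : ℂ)) (s := ball (0 : ℂ) R)
    (𝕜 := ℂ)).circleAverage_re_herglotzRieszKernel_smul hw
  have hR0 : 0 < R := pos_of_mem_ball hw
  have hi : CircleIntegrable (fun ζ => (herglotzRieszKernel 0 w ζ).re) 0 R :=
    (continuousOn_re_herglotzRieszKernel hw).circleIntegrable hR0.le
  have h2 := ofRealCLM.circleAverage_comp_comm hi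
  have h3 : circleAverage (ofRealCLM ∘ fun ζ => (herglotzRieszKernel 0 w ζ).re) 0 R = 1 := by
    rw [← h1]
    congr 1
    ext ζ
    simp
  rw [h3] at h2
  exact ofReal_injective (h2.symm.trans ofReal_one.symm)

end Poisson

/-- **Littlewood subordination**: composition with a holomorphic self-map of the disk maps `H²`
into itself. -/
lemma IsSelfMap.comp_mem_H2 {φ f : ℂ → ℂ} (hφ : IsSelfMap φ) (hf : f ∈ H2) : f ∘ φ ∈ H2 := by
  obtain ⟨hfh, M, hM⟩ := mem_H2_iff.1 hf
  have hφc : ContinuousOn φ disk := hφ.1.continuousOn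
  have hfc : ContinuousOn f disk := hfh.continuousOn
  have hcomp : Holomorphic (f ∘ φ) := hfh.comp hφ.1 hφ.2
  have hcompc : ContinuousOn (f ∘ φ) disk := hcomp.continuousOn
  have hφ0 : ‖φ 0‖ < 1 := by simpa using hφ.2 (show (0 : ℂ) ∈ disk by simp)
  -- The constant bounds the Poisson kernel at `φ 0` on the circle of radius `R` below: `R + ‖φ 0‖ ≤
  -- 2` and `R - ‖φ 0‖ ≥ (1 - ‖φ 0‖) / 2`. It does not depend on `r`.
  refine mem_H2_iff.2 ⟨hcomp, 4 / (1 - ‖φ 0‖) * M, fun r hr => ?_⟩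
  -- a circle of radius `R < 1` enclosing the image of the closed disk of radius `r`
  obtain ⟨z₁, hz₁, hmax⟩ := (isCompact_closedBall (0 : ℂ) r).exists_isMaxOn
    ⟨0, by simpa using hr.1⟩ ((hφc.mono (closedBall_subset_disk hr.2)).norm)
  have hm : ‖φ z₁‖ < 1 := by simpa using hφ.2 (closedBall_subset_disk hr.2 hz₁)
  set R := (1 + ‖φ z₁‖) / 2 with hRdef
  have hR1 : R < 1 := by linarith
  have hm0 := norm_nonneg (φ z₁)
  have hR0 : 0 < R := by linarith
  have hmaps : MapsTo φ (closedBall 0 r) (ball 0 R) := fun z hz => by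
    have : ‖φ z‖ ≤ ‖φ z₁‖ := hmax hz
    rw [mem_ball_zero_iff]
    linarith
  have h0r : (0 : ℂ) ∈ closedBall 0 r := by simpa using hr.1
  have hφ0R : φ 0 ∈ ball 0 R := hmaps h0r
  have hφ0m : ‖φ 0‖ ≤ ‖φ z₁‖ := hmax h0r
  have hgi : CircleIntegrable (fun ζ => ‖f ζ‖ ^ 2) 0 R :=
    circleIntegrable_of_continuousOn_disk (by fun_prop) hR0.le hR1
  -- the Herglotz integral, whose real part is a harmonic majorant of `‖f‖ ^ 2`
  set G : ℂ → ℂ := fun w =>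
    circleAverage (fun ζ => herglotzRieszKernel 0 w ζ • ((‖f ζ‖ ^ 2 : ℝ) : ℂ)) 0 R with hG
  have hGre : ∀ w ∈ ball (0 : ℂ) R, (G w).re =
      circleAverage (fun ζ => (herglotzRieszKernel 0 w ζ).re * ‖f ζ‖ ^ 2) 0 R := fun w hw =>
    re_circleAverage_herglotzRieszKernel_smul hgi hw
  have hGd : DifferentiableOn ℂ G (ball 0 R) := by
    refine differentiableOn_circleAverage_herglotzRieszKernel_smul ?_
    exact circleIntegrable_of_continuousOn_disk (by fun_prop) hR0.le hR1
  have hGφ : DifferentiableOn ℂ (G ∘ φ) (closedBall 0 r) :=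
    hGd.comp (hφ.1.mono (closedBall_subset_disk hr.2)) hmaps
  have hGφi : CircleIntegrable (G ∘ φ) 0 r :=
    (hGφ.continuousOn.mono sphere_subset_closedBall).circleIntegrable hr.1
  -- The mean value property collapses the average of the majorant over the `r`-circle to its value
  -- at `φ 0`.
  have hmv : circleAverage (G ∘ φ) 0 r = G (φ 0) := by
    have : DiffContOnCl ℂ (G ∘ φ) (ball 0 |r|) := by
      refine DifferentiableOn.diffContOnCl (hGφ.mono ?_)
      rw [abs_of_nonneg hr.1]
      exact closure_ball_subset_closedBall
    exact this.circleAverage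
  have hmvre : circleAverage (fun z => (G (φ z)).re) 0 r = (G (φ 0)).re := by
    rw [← hmv]
    exact reCLM.circleAverage_comp_comm hGφi
  have hre : CircleIntegrable (fun z => (G (φ z)).re) 0 r :=
    (continuous_re.comp_continuousOn
      (hGφ.continuousOn.mono sphere_subset_closedBall)).circleIntegrable hr.1
  calc circleAverage (fun z => ‖(f ∘ φ) z‖ ^ 2) 0 r
      ≤ circleAverage (fun z => (G (φ z)).re) 0 r := by
        refine circleAverage_mono
          (circleIntegrable_of_continuousOn_disk (hcompc.norm.pow 2) hr.1 hr.2) hre fun z hz => ?_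
        rw [abs_of_nonneg hr.1] at hz
        have hz' := hmaps (sphere_subset_closedBall hz)
        have hsq : Holomorphic (fun z => f z ^ 2) := hfh.pow 2
        have := norm_le_circleAverage_re_herglotzRieszKernel hsq hR1 hz'
        simp only [norm_pow] at this
        exact this.trans_eq (hGre _ hz').symm
    _ = circleAverage (fun ζ => (herglotzRieszKernel 0 (φ 0) ζ).re * ‖f ζ‖ ^ 2) 0 R := by
        rw [hmvre, hGre _ hφ0R]
    _ ≤ circleAverage (fun ζ => (4 / (1 - ‖φ 0‖)) • ‖f ζ‖ ^ 2) 0 R := by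
        have hfs := hfc.mono (sphere_subset_disk hR1)
        have hK := continuousOn_re_herglotzRieszKernel hφ0R
        refine circleAverage_mono
          (ContinuousOn.circleIntegrable hR0.le (hK.mul (hfs.norm.pow 2)))
          (hgi.const_smul (a := 4 / (1 - ‖φ 0‖))) fun ζ hζ => ?_
        rw [abs_of_pos hR0] at hζ
        rw [smul_eq_mul]
        gcongr
        refine (re_herglotzRieszKernel_le' hφ0R hζ).trans ?_
        rw [div_le_div_iff₀ (by linarith) (by linarith)]
        nlinarith [norm_nonneg (φ 0)]
    _ = 4 / (1 - ‖φ 0‖) * circleAverage (fun ζ => ‖f ζ‖ ^ 2) 0 R := by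
        rw [circleAverage_fun_smul, smul_eq_mul]
    _ ≤ 4 / (1 - ‖φ 0‖) * M := by
        have : 0 ≤ 1 - ‖φ 0‖ := by linarith
        gcongr
        exact hM R ⟨hR0.le, hR1⟩

/-- The defect of an inner function tends to zero in mean square on circles. -/
lemma IsInner.tendsto_circleAverage_one_sub_norm_sq {θ : ℂ → ℂ} (hθ : IsInner θ) :
    Tendsto (fun r => circleAverage (fun z => (1 - ‖θ z‖) ^ 2) 0 r) (𝓝[<] 1) (𝓝 0) := by
  obtain ⟨hd, hb, hlim⟩ := hθ
  have hc : ContinuousOn θ disk := hd.continuousOn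
  have hev : ∀ᶠ r in 𝓝[<] (1 : ℝ), 0 ≤ r ∧ r < 1 := by
    filter_upwards [Ioo_mem_nhdsLT (zero_lt_one (α := ℝ))] with r hr using ⟨hr.1.le, hr.2⟩
  have h2π : (0 : ℝ) ≤ 2 * π := by positivity
  have key : Tendsto (fun r => ∫ t in 0..2 * π, (1 - ‖θ (circleMap 0 r t)‖) ^ 2) (𝓝[<] 1)
      (𝓝 (∫ _ in 0..2 * π, (0 : ℝ))) := by
    refine intervalIntegral.tendsto_integral_filter_of_dominated_convergence (fun _ => 1)
      ?_ ?_ intervalIntegrable_const ?_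
    · filter_upwards [hev] with r hr
      have : CircleIntegrable (fun z => (1 - ‖θ z‖) ^ 2) 0 r :=
        circleIntegrable_of_continuousOn_disk (by fun_prop) hr.1 hr.2
      exact (intervalIntegrable_iff.1 this).aestronglyMeasurable
    · filter_upwards [hev] with r hr
      refine Eventually.of_forall fun t _ => ?_
      have h1 := hb _ (sphere_subset_disk hr.2 (circleMap_mem_sphere 0 hr.1 t))
      have h0 := norm_nonneg (θ (circleMap 0 r t))
      rw [Real.norm_of_nonneg (sq_nonneg _)]
      exact pow_le_one₀ (by linarith) (by linarith)
    · rw [uIoc_of_le h2π]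
      filter_upwards [(ae_restrict_iff' measurableSet_Ioc).1 hlim] with t ht htm
      obtain ⟨w, hw, hwl⟩ := ht htm
      have := ((hwl.norm.const_sub 1).pow 2)
      simpa [hw] using this
  simpa [circleAverage_def] using key.const_mul (2 * π)⁻¹

/-- An inner function does not vanish identically on the disk. -/
lemma IsInner.exists_ne_zero {θ : ℂ → ℂ} (hθ : IsInner θ) : ∃ z ∈ disk, θ z ≠ 0 := by
  by_contra! h
  have h1 : Tendsto (fun _ : ℝ => (1 : ℝ)) (𝓝[<] 1) (𝓝 0) := by
    refine hθ.tendsto_circleAverage_one_sub_norm_sq.congr' ?_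
    filter_upwards [Ioo_mem_nhdsLT (zero_lt_one (α := ℝ))] with r hr
    refine Eq.trans ?_ (circleAverage_const (1 : ℝ) 0 r)
    refine circleAverage_congr_sphere fun z hz => ?_
    rw [abs_of_pos hr.1] at hz
    simp [h z (sphere_subset_disk hr.2 hz)]
  exact one_ne_zero (tendsto_nhds_unique tendsto_const_nhds h1)

/-- A function `h ∈ H²` for which `θh` is a Schur function, with `θ` inner, is a Schur function. -/
lemma IsInner.norm_le_one_of_norm_mul_le_one {θ h : ℂ → ℂ} (hθ : IsInner θ) (hh : h ∈ H2)
    (hmul : ∀ z ∈ disk, ‖θ z * h z‖ ≤ 1) {w : ℂ} (hw : w ∈ disk) : ‖h w‖ ≤ 1 := by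
  obtain ⟨hd, M, hM⟩ := mem_H2_iff.1 hh
  have hθc : ContinuousOn θ disk := hθ.1.continuousOn
  have hhc : ContinuousOn h disk := hd.continuousOn
  have hw1 : ‖w‖ < 1 := by simpa using hw
  -- `C` bounds the Poisson kernel at `w` on every circle of radius `r > (1 + ‖w‖) / 2`, `r < 1`.
  set C := 4 / (1 - ‖w‖) with hC
  have hC0 : 0 < C := div_pos (by norm_num) (by linarith)
  -- Young's inequality with weight `δ` splits the error into a small multiple of the mean of `‖h‖ ^
  -- 2` and a large multiple of the defect. Letting `r → 1` first removes the defect; `δ → 0` then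
  -- removes the rest.
  have step : ∀ δ > 0, ‖h w‖ ≤ 1 + C * δ * M := by
    intro δ hδ
    have hlim : Tendsto (fun r => 1 + C * δ * M +
        C * δ⁻¹ * circleAverage (fun z => (1 - ‖θ z‖) ^ 2) 0 r) (𝓝[<] 1)
        (𝓝 (1 + C * δ * M)) := by
      simpa using (hθ.tendsto_circleAverage_one_sub_norm_sq.const_mul (C * δ⁻¹)).const_add
        (1 + C * δ * M)
    refine ge_of_tendsto hlim ?_
    filter_upwards [Ioo_mem_nhdsLT (show (1 + ‖w‖) / 2 < 1 by linarith)] with r hr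
    have hr1 : r < 1 := hr.2
    have hrw : (1 + ‖w‖) / 2 < r := hr.1
    have hw0 := norm_nonneg w
    have hr0 : 0 < r := by linarith
    have hwr : w ∈ ball 0 r := by
      rw [mem_ball_zero_iff]
      linarith
    have hK : CircleIntegrable (fun ζ => (herglotzRieszKernel 0 w ζ).re) 0 r :=
      (continuousOn_re_herglotzRieszKernel hwr).circleIntegrable hr0.le
    have hi1 : CircleIntegrable (fun ζ => (C * δ) • ‖h ζ‖ ^ 2) 0 r :=
      circleIntegrable_of_continuousOn_disk (by fun_prop) hr0.le hr1
    have hi2 : CircleIntegrable (fun ζ => (C * δ⁻¹) • (1 - ‖θ ζ‖) ^ 2) 0 r :=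
      circleIntegrable_of_continuousOn_disk (by fun_prop) hr0.le hr1
    calc ‖h w‖ ≤ circleAverage (fun ζ => (herglotzRieszKernel 0 w ζ).re * ‖h ζ‖) 0 r :=
          norm_le_circleAverage_re_herglotzRieszKernel hd hr1 hwr
      _ ≤ circleAverage (fun ζ => (herglotzRieszKernel 0 w ζ).re + (C * δ) • ‖h ζ‖ ^ 2 +
            (C * δ⁻¹) • (1 - ‖θ ζ‖) ^ 2) 0 r := by
          have hhs := hhc.mono (sphere_subset_disk hr1)
          refine circleAverage_mono (ContinuousOn.circleIntegrable hr0.le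
            ((continuousOn_re_herglotzRieszKernel hwr).mul hhs.norm))
            ((hK.add hi1).add hi2) fun ζ hζ => ?_
          rw [abs_of_pos hr0] at hζ
          have hP0 := re_herglotzRieszKernel_nonneg hwr hζ
          have hPC : (herglotzRieszKernel 0 w ζ).re ≤ C := by
            refine (re_herglotzRieszKernel_le' hwr hζ).trans ?_
            rw [hC, div_le_div_iff₀ (by linarith) (by linarith)]
            nlinarith
          have hp := hmul ζ (sphere_subset_disk hr1 hζ)
          rw [norm_mul] at hp
          simp only [smul_eq_mul]
          set P := (herglotzRieszKernel 0 w ζ).re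
          set a := ‖h ζ‖
          set b := 1 - ‖θ ζ‖ with hb
          have hyoung : a * b ≤ δ * a ^ 2 + δ⁻¹ * b ^ 2 := by
            have h1 : 0 ≤ δ⁻¹ * ((δ * a - b) ^ 2 + (δ * a) ^ 2 + b ^ 2) := by positivity
            have h2 : δ⁻¹ * ((δ * a - b) ^ 2 + (δ * a) ^ 2 + b ^ 2) =
                2 * (δ * a ^ 2 + δ⁻¹ * b ^ 2 - a * b) := by
              field_simp
              ring
            linarith
          have ha : a ≤ 1 + (δ * a ^ 2 + δ⁻¹ * b ^ 2) := by
            have : a = ‖θ ζ‖ * a + a * b := by rw [hb]; ring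
            linarith
          calc P * a ≤ P * (1 + (δ * a ^ 2 + δ⁻¹ * b ^ 2)) := by gcongr
            _ = P + P * (δ * a ^ 2 + δ⁻¹ * b ^ 2) := by ring
            _ ≤ P + C * (δ * a ^ 2 + δ⁻¹ * b ^ 2) := by gcongr
            _ = P + C * δ * a ^ 2 + C * δ⁻¹ * b ^ 2 := by ring
      _ = 1 + C * δ * circleAverage (fun ζ => ‖h ζ‖ ^ 2) 0 r +
            C * δ⁻¹ * circleAverage (fun z => (1 - ‖θ z‖) ^ 2) 0 r := by
          have hi12 : CircleIntegrable (fun ζ => (herglotzRieszKernel 0 w ζ).re +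
              (C * δ) • ‖h ζ‖ ^ 2) 0 r := hK.add hi1
          rw [circleAverage_fun_add hi12 hi2, circleAverage_fun_add hK hi1,
            circleAverage_re_herglotzRieszKernel hwr, circleAverage_fun_smul,
            circleAverage_fun_smul, smul_eq_mul, smul_eq_mul]
      _ ≤ _ := by
          gcongr
          exact hM r ⟨hr0.le, hr1⟩
  have hlim : Tendsto (fun δ : ℝ => 1 + C * δ * M) (𝓝[>] 0) (𝓝 1) := by
    have : Continuous fun δ : ℝ => 1 + C * δ * M := by fun_prop
    simpa using (this.tendsto 0).mono_left nhdsWithin_le_nhds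
  exact ge_of_tendsto hlim (eventually_mem_nhdsWithin.mono step)

/-- A holomorphic identity that holds off the zeros of an inner function holds on the disk. -/
lemma IsInner.eqOn_of_eqOn_ne_zero {θ u v : ℂ → ℂ} (hθ : IsInner θ) (hu : Holomorphic u)
    (hv : Holomorphic v) (huv : ∀ z ∈ disk, θ z ≠ 0 → u z = v z) : EqOn u v disk := by
  have hθa : AnalyticOnNhd ℂ θ disk := hθ.1.analyticOnNhd isOpen_ball
  have hda : AnalyticOnNhd ℂ (fun z => u z - v z) disk := (hu.sub hv).analyticOnNhd isOpen_ball
  -- The product `θ (u - v)` vanishes on the whole disk, and analytic functions on a connected set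
  -- have no zero divisors.
  rcases AnalyticOnNhd.eq_zero_or_eq_zero_of_mul_eq_zero hθa hda (fun z hz => by
    by_cases h : θ z = 0
    · simp [h]
    · simp [huv z hz h]) isPreconnected_disk with h | h
  · obtain ⟨z, hz, hne⟩ := hθ.exists_ne_zero
    exact absurd (h z hz) hne
  · exact fun z hz => sub_eq_zero.1 (h z hz)

end HardyDisk

theorem theorem2p2 (φ θ : ℂ → ℂ) (hφ : HardyDisk.IsSelfMap φ) (hθ : HardyDisk.IsInner θ) :
    Set.MapsTo (HardyDisk.compOp φ) (HardyDisk.mulH2 θ) (HardyDisk.mulH2 θ) ↔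
      HardyDisk.QuotientIsSchur (θ ∘ φ) θ := by
  constructor
  · intro hinv
    obtain ⟨h, hh, heq⟩ := hinv (show θ ∈ HardyDisk.mulH2 θ from
      ⟨fun _ => 1, HardyDisk.one_mem_H2, fun z _ => (mul_one _).symm⟩)
    refine ⟨h, ⟨hh.1, fun z hz => hθ.norm_le_one_of_norm_mul_le_one hh (fun ζ hζ => ?_) hz⟩,
      fun z hz hne => ?_⟩
    · exact (congrArg norm (heq hζ)).symm.trans_le (hθ.2.1 _ (hφ.2 hζ))
    · exact eq_div_of_mul_eq hne ((mul_comm _ _).trans (heq hz).symm)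
  · rintro ⟨g, hg, hquot⟩ F ⟨h, hh, hF⟩
    have heq : EqOn (θ ∘ φ) (fun z => θ z * g z) HardyDisk.disk :=
      hθ.eqOn_of_eqOn_ne_zero (hθ.1.comp hφ.1 hφ.2) (hθ.1.mul hg.1) fun z hz hne => by
        rw [hquot z hz hne, mul_div_cancel₀ _ hne]
    refine ⟨_, HardyDisk.Schur.mul_mem_H2 hg (hφ.comp_mem_H2 hh), fun z hz => ?_⟩
    have h1 : F (φ z) = θ (φ z) * h (φ z) := hF (hφ.2 hz)
    have h2 : θ (φ z) = θ z * g z := heq hz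
    simp only [HardyDisk.compOp, Function.comp_apply]
    rw [h1, h2, mul_assoc]
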